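/- Let $(\mathcal Q,d)$ be a Hadamard space, i.e. a nonempty complete metric space such that for all $y_0,y_1\in\mathcal Q$ there is $z\in\mathcal Q$ with $d(q,z)^2\le \tfrac12 d(y_0,q)^2+\tfrac12 d(y_1,q)^2-\tfrac14 d(y_0,y_1)^2$ for all $q\in\mathcal Q$, equipped with its Borel $\sigma$-algebra. Let $Y$ be a $\mathcal Q$-valued random variable on a probability space $(\Omega,\Sigma,\mathbb P)$ that takes values almost surely in some separable subset of $\mathcal Q$ (automatic if $\mathcal Q$ is separable). Let $\alpha\in(1,2]$, let $m\in\arg\min_{q\in\mathcal Q}\mathbb E[d(Y,q)^\alpha]$ be the $\alpha$-Fréchet mean of $Y$, and assume $\mathbb E[d(Y,m)^\alpha]<\infty$. Suppose there are $\varepsilon,c>0$ and $\beta\in[\alpha,2]$ such that $$\mathbb P(d(Y,m)\le x)\ \ge\ c\,x^{\beta-\alpha}\qquad\text{for all }x\in(0,\varepsilon].$$ For $n\ge 1$ and independent copies $Y_1,\dots,Y_n$ of $Y$ defined on $\Omega$, let $m_n\in\arg\min_{q\in\mathcal Q}\sum_{i=1}^n d(Y_i,q)^\alpha$ denote the sample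 $\alpha$-Fréchet mean. Then: 1. There is a constant $C\in(0,\infty)$, not depending on $n$ or on the choice of the sample, such that for all $n\ge1$ $$\mathbb E\bigl[\min\bigl(d(m,m_n)^\beta,\ d(m,m_n)^\alpha\bigr)\bigr]\ \le\ \frac Cn ,$$ where the random variable inside the expectation is integrable. 2. Consequently $d(m,m_n)\in O_{\mathbb P}(n^{-1/\beta})$: for every $\eta>0$ there is $K\in(0,\infty)$ such that $\mathbb P\bigl(d(m,m_n)>K n^{-1/\beta}\bigr)\le\eta$ for all $n\ge1$. 3. If $\beta<2$, this rate is faster than the parametric rate: $n^{-1/\beta}=o(n^{-1/2})$ as $n\to\infty$. -/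

import Mathlib

open MeasureTheory ProbabilityTheory Filter Set

/-- A Hadamard space: a nonempty complete metric space in which every pair of points has a
midpoint satisfying the nonpositive-curvature inequality. -/
structure IsHadamard (Q : Type*) [MetricSpace Q] : Prop where
  nonempty : Nonempty Q
  complete : CompleteSpace Q
  midpoint : ∀ y₀ y₁ : Q, ∃ m : Q, ∀ q : Q,
    dist q m ^ 2 ≤ (1 / 2) * dist y₀ q ^ 2 + (1 / 2) * dist y₁ q ^ 2 - (1 / 4) * dist y₀ y₁ ^ 2

/-- `m` is a minimizer of `q ↦ E[d(Y, q) ^ α]`. It is used only when these expectations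
are finite. -/
def IsPowerFrechetMean {Q Ω : Type*} [MetricSpace Q] [MeasurableSpace Ω] (P : Measure Ω)
    (α : ℝ) (Y : Ω → Q) (m : Q) : Prop :=
  IsMinOn (fun q : Q => ∫ ω, dist (Y ω) q ^ α ∂P) univ m

/-- `q₀` is a minimizer of `q ↦ ∑ i, d(y i, q) ^ α`, for data points `y 0, …, y (n - 1)`. -/
def IsSamplePowerFrechetMean {Q : Type*} [MetricSpace Q] {n : ℕ} (α : ℝ) (y : Fin n → Q)
    (q₀ : Q) : Prop :=
  IsMinOn (fun q : Q => ∑ i, dist (y i) q ^ α) univ q₀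

/-- The family `Z` consists of independent copies of the random variable `Y`. -/
structure IsIIDSample {Q Ω : Type*} [MeasurableSpace Q] [MeasurableSpace Ω] (P : Measure Ω)
    (Y : Ω → Q) {n : ℕ} (Z : Fin n → Ω → Q) : Prop where
  indep : iIndepFun Z P
  ident : ∀ i, IdentDistrib (Z i) Y P P

/-! Write F(q) = E[d(Y,q)^α]. The rate follows from two bounds on the excess risk F(m_n) - F(m): a
deterministic lower bound by a multiple of min(d^β, d^α) with d = d(m,m_n), and an upper bound C/n
in expectation. No empirical process theory enters.

Lower bound (`IsHadamard.exists_min_le_excess`): comparing F(m) with F at the midpoint of m and q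
gains about d(m,q)² times the average of a distance to the power α-2. Since α-2 ≤ 0, data close to m
contribute most, and the small ball condition turns this into the power β.

Upper bound (`IsHadamard.integral_excess_le`): this is algorithmic stability. Exchanging one
observation for an independent one moves the sample mean by O(1/n) (`IsHadamard.sample_stability`),
and the quadruple inequality (`IsHadamard.rpow_quadruple_le`) turns this into an O(1/n) bound on the
second difference of the loss. By exchangeability its expectation is twice the gap between the loss
at a fresh point and the loss at a sample point, and the average loss at sample points is at most
that of m. The powers of distances that arise have total degree exactly α, so the α-th moment
suffices. -/

/-! ### Scalar inequalities for powers. -/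

/-- Strong convexity of `x ↦ x ^ α` on `[0, M]`, at midpoints. -/
theorem rpow_midpoint_le {α A B M : ℝ} (hα : 1 < α) (hα2 : α ≤ 2) (hA : 0 ≤ A) (hB : 0 ≤ B)
    (hAM : A ≤ M) (hBM : B ≤ M) :
    ((A + B) / 2) ^ α ≤
      (A ^ α + B ^ α) / 2 - α * (α - 1) / 8 * (A - B) ^ 2 * M ^ (α - 2) := by
  -- Half the smallest second derivative of `x ^ α` on `(0, M]`; as `α - 2 ≤ 0`, the minimum is at
  -- `M`.
  set k : ℝ := α * (α - 1) / 2 * M ^ (α - 2) with hk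
  have hconv : ConvexOn ℝ (Icc 0 M) (fun x : ℝ => x ^ α - k * x ^ 2) := by
    refine convexOn_of_hasDerivWithinAt2_nonneg (convex_Icc 0 M)
      (f' := fun x => α * x ^ (α - 1) - k * (2 * x))
      (f'' := fun x => α * ((α - 1) * x ^ (α - 2)) - k * 2) ?_ ?_ ?_ ?_
    · have : Continuous (fun x : ℝ => x ^ α) := Real.continuous_rpow_const (by linarith)
      fun_prop
    · intro x hx
      rw [interior_Icc] at hx
      have h1 := Real.hasDerivAt_rpow_const (x := x) (p := α) (Or.inl hx.1.ne')
      have h2 := ((hasDerivAt_pow 2 x).const_mul k)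
      have h3 := (h1.sub h2).hasDerivWithinAt (s := interior (Icc 0 M))
      refine h3.congr_deriv ?_
      simp
    · intro x hx
      rw [interior_Icc] at hx
      have h1 := (Real.hasDerivAt_rpow_const (x := x) (p := α - 1)
        (Or.inl hx.1.ne')).const_mul α
      have h2 := (((hasDerivAt_id x).const_mul 2).const_mul k)
      have h3 := (h1.sub h2).hasDerivWithinAt (s := interior (Icc 0 M))
      rw [show α - 1 - 1 = α - 2 by ring] at h3
      refine h3.congr_deriv ?_
      simp
    · intro x hx
      rw [interior_Icc] at hx
      have : M ^ (α - 2) ≤ x ^ (α - 2) :=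
        Real.rpow_le_rpow_of_nonpos hx.1 hx.2.le (by linarith)
      have h0 : 0 ≤ α * (α - 1) := by nlinarith
      have := mul_le_mul_of_nonneg_left this h0
      simp only [hk]
      linarith
  have h := hconv.2 (show A ∈ Icc 0 M from ⟨hA, hAM⟩) (show B ∈ Icc 0 M from ⟨hB, hBM⟩)
    (show (0 : ℝ) ≤ 1 / 2 by norm_num) (show (0 : ℝ) ≤ 1 / 2 by norm_num) (by norm_num)
  simp only [smul_eq_mul] at h
  rw [show 1 / 2 * A + 1 / 2 * B = (A + B) / 2 by ring] at h
  have : α * (α - 1) / 8 * (A - B) ^ 2 * M ^ (α - 2) = k * (A - B) ^ 2 / 4 := by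
    rw [hk]; ring
  rw [this]
  nlinarith

/-- The power function `v ↦ v ^ α` as a concave function of `v ^ 2`: tangent bound at `u ^ 2`. -/
theorem rpow_le_tangent_sq {α u v : ℝ} (hα : 1 < α) (hα2 : α ≤ 2) (hu : 0 < u) (hv : 0 ≤ v) :
    v ^ α ≤ u ^ α + α / 2 * u ^ (α - 2) * (v ^ 2 - u ^ 2) := by
  have h := rpow_one_add_le_one_add_mul_self (s := (v / u) ^ 2 - 1) (p := α / 2)
    (by nlinarith [sq_nonneg (v / u)]) (by linarith) (by linarith)
  rw [show 1 + ((v / u) ^ 2 - 1) = (v / u) ^ (2 : ℝ) by norm_cast; ring,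
    ← Real.rpow_mul (by positivity), show 2 * (α / 2) = α by ring,
    Real.div_rpow hv hu.le, div_le_iff₀ (by positivity)] at h
  have e : u ^ α = u ^ (α - 2) * u ^ 2 := by
    rw [← Real.rpow_natCast u 2, ← Real.rpow_add hu]; norm_num
  refine h.trans (le_of_eq ?_)
  rw [e]; field_simp

/-- Uniform convexity of `t ↦ t ^ α` along pairs subject to the parallelogram bound. -/
theorem rpow_le_of_sq_le {α A B W a M : ℝ} (hα : 1 < α) (hα2 : α ≤ 2) (hA : 0 ≤ A) (hB : 0 ≤ B)
    (hW : 0 ≤ W) (hAM : A ≤ M) (hBM : B ≤ M) (hAB : |A - B| ≤ a)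
    (h : W ^ 2 ≤ 1 / 2 * A ^ 2 + 1 / 2 * B ^ 2 - 1 / 4 * a ^ 2) :
    W ^ α ≤ (A ^ α + B ^ α) / 2 - α * (α - 1) / 8 * a ^ 2 * M ^ (α - 2) := by
  have ha : 0 ≤ a := (abs_nonneg _).trans hAB
  rcases eq_or_lt_of_le (show 0 ≤ (A + B) / 2 by positivity) with h0 | h0
  · have hA0 : A = 0 := by linarith
    have hB0 : B = 0 := by linarith
    subst hA0 hB0
    have ha0 : a = 0 := by nlinarith [sq_nonneg W, sq_nonneg a]
    have hW0 : W = 0 := by subst ha0; nlinarith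
    subst ha0 hW0
    simp [Real.zero_rpow (show α ≠ 0 by linarith)]
  · have h1 := rpow_le_tangent_sq hα hα2 h0 hW
    have h2 := rpow_midpoint_le hα hα2 hA hB hAM hBM
    have h3 : M ^ (α - 2) ≤ ((A + B) / 2) ^ (α - 2) :=
      Real.rpow_le_rpow_of_nonpos h0 (by linarith) (by linarith)
    have hd : 0 ≤ a ^ 2 - (A - B) ^ 2 := by
      have := abs_le.1 hAB
      nlinarith
    have hM : 0 ≤ M ^ (α - 2) := Real.rpow_nonneg (hA.trans hAM) _
    -- Uses (A² + B²)/2 = ((A+B)/2)² + ((A-B)/2)². Concavity in the square handles the part a² -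
    -- (A-B)², and strong convexity handles (A-B)².
    have h4 : W ^ 2 - ((A + B) / 2) ^ 2 ≤ -((a ^ 2 - (A - B) ^ 2) / 4) := by nlinarith
    have h5 : α / 2 * ((A + B) / 2) ^ (α - 2) * (W ^ 2 - ((A + B) / 2) ^ 2) ≤
        α / 2 * M ^ (α - 2) * (-((a ^ 2 - (A - B) ^ 2) / 4)) := by
      have h6 := mul_le_mul_of_nonneg_left h4
        (show 0 ≤ α / 2 * ((A + B) / 2) ^ (α - 2) by positivity)
      have h7 := mul_le_mul_of_nonneg_right
        (mul_le_mul_of_nonneg_left h3 (show 0 ≤ α / 2 by linarith))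
        (show 0 ≤ (a ^ 2 - (A - B) ^ 2) / 4 by linarith)
      linarith
    -- The first part comes with constant α/8 where only α(α-1)/8 is needed; this is the surplus.
    have h8 : 0 ≤ α * (2 - α) / 8 * (M ^ (α - 2) * (a ^ 2 - (A - B) ^ 2)) :=
      mul_nonneg (by nlinarith) (mul_nonneg hM hd)
    nlinarith

/-- For t = u/s in [0,1] one has t^α ≥ t² ≥ 2t - 1, which is a mean value bound with constant 2 in
place of α. -/
theorem rpow_sub_rpow_le {α s u a N : ℝ} (hα : 1 < α) (hα2 : α ≤ 2) (hs : 0 ≤ s) (hu : 0 ≤ u)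
    (hsN : s ≤ N) (ha : 0 ≤ a) (hsu : s - u ≤ a) :
    s ^ α - u ^ α ≤ 2 * a * N ^ (α - 1) := by
  have hN : 0 ≤ N := hs.trans hsN
  rcases le_or_gt s u with h | h
  · have := Real.rpow_le_rpow hs h (by linarith : (0:ℝ) ≤ α)
    have : 0 ≤ 2 * a * N ^ (α - 1) := by positivity
    linarith
  · have hs0 : 0 < s := lt_of_le_of_lt hu h
    have e : s ^ α = s ^ (α - 1) * s := by
      rw [← Real.rpow_add_one hs0.ne']; norm_num
    have h1 : s ^ (α - 1) ≤ N ^ (α - 1) := Real.rpow_le_rpow hs hsN (by linarith)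
    have h2 : (u / s) ^ (2 : ℝ) ≤ (u / s) ^ α :=
      Real.rpow_le_rpow_of_exponent_ge' (by positivity) ((div_le_one hs0).2 h.le)
        (by linarith) hα2
    have h3 : 2 * (u / s) - 1 ≤ (u / s) ^ α := by
      refine le_trans ?_ h2
      norm_cast
      nlinarith [sq_nonneg (u / s - 1)]
    rw [Real.div_rpow hu hs, le_div_iff₀ (by positivity)] at h3
    have h4 : (2 * (u / s) - 1) * s ^ α = s ^ (α - 1) * (2 * u - s) := by
      rw [e]; field_simp
    have h5 : 0 ≤ s ^ (α - 1) := by positivity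
    calc s ^ α - u ^ α ≤ 2 * (s - u) * s ^ (α - 1) := by rw [h4] at h3; rw [e]; linarith
      _ ≤ 2 * a * s ^ (α - 1) := by gcongr
      _ ≤ 2 * a * N ^ (α - 1) := by gcongr

/-- For u ≤ v, replacing v^(α-1) by the smaller u^(α-1) leaves u^(α-2)(v - u). The factor `max u v`
is there to absorb a difference of squares when two tangent slopes are compared. -/
theorem rpow_sub_two_lipschitz {α b u v : ℝ} (hα : 1 < α) (hα2 : α ≤ 2) (hb : 0 < b)
    (hbu : b ≤ u) (hbv : b ≤ v) :
    |v ^ (α - 2) - u ^ (α - 2)| * max u v ≤ b ^ (α - 2) * |u - v| := by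
  wlog h : u ≤ v generalizing u v
  · have := this hbv hbu (le_of_not_ge h)
    rwa [abs_sub_comm, max_comm, abs_sub_comm v u] at this
  have hu : 0 < u := hb.trans_le hbu
  have hv : 0 < v := hb.trans_le hbv
  have h1 : v ^ (α - 2) ≤ u ^ (α - 2) := Real.rpow_le_rpow_of_nonpos hu h (by linarith)
  have h2 : u ^ (α - 2) ≤ b ^ (α - 2) := Real.rpow_le_rpow_of_nonpos hb hbu (by linarith)
  have h3 : u ^ (α - 1) ≤ v ^ (α - 1) := Real.rpow_le_rpow hu.le h (by linarith)
  have eu : u ^ (α - 1) = u ^ (α - 2) * u := by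
    rw [← Real.rpow_add_one hu.ne']; ring_nf
  have ev : v ^ (α - 1) = v ^ (α - 2) * v := by
    rw [← Real.rpow_add_one hv.ne']; ring_nf
  rw [max_eq_right h, abs_of_nonpos (by linarith), abs_of_nonpos (by linarith)]
  have := mul_le_mul_of_nonneg_right h2 (sub_nonneg.2 h)
  nlinarith

/-! ### Quadruple inequalities. -/

/-- The curvature inequality for the midpoint u of one diagonal, tested at both ends of the other,
combines with d(z,p)² ≤ 2(d(z,u)² + d(p,u)²). -/
theorem IsHadamard.sq_quadruple_le_add {Q : Type*} [MetricSpace Q] (hQ : IsHadamard Q)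
    (y z p q : Q) :
    dist y q ^ 2 - dist y p ^ 2 - dist z q ^ 2 + dist z p ^ 2 ≤
      dist p q ^ 2 + dist y z ^ 2 := by
  obtain ⟨u, hu⟩ := hQ.midpoint y q
  have h1 := hu p
  have h2 := hu z
  have h3 := dist_triangle_right z p u
  have h4 : dist z p ^ 2 ≤ (dist z u + dist p u) ^ 2 := pow_le_pow_left₀ dist_nonneg h3 2
  rw [dist_comm q p] at h1
  rw [dist_comm q z] at h2
  nlinarith [sq_nonneg (dist z u - dist p u)]

theorem IsHadamard.exists_midpoint {Q : Type*} [MetricSpace Q] (hQ : IsHadamard Q) (y z : Q) :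
    ∃ w : Q, dist y w ≤ dist y z / 2 ∧ dist w z ≤ dist y z / 2 := by
  obtain ⟨w, hw⟩ := hQ.midpoint y z
  refine ⟨w, ?_, ?_⟩
  · have := hw y
    rw [dist_self, dist_comm z y] at this
    exact abs_le_of_sq_le_sq' (by nlinarith) (by positivity) |>.2
  · have := hw z
    rw [dist_self, dist_comm z w] at this
    exact abs_le_of_sq_le_sq' (by nlinarith) (by positivity) |>.2

/-- The left side telescopes along a chain from y to z. Bisecting k times gives 2^k links of length
at most d(y,z)/2^k, to each of which the additive form applies. -/
theorem IsHadamard.sq_quadruple_le_two_pow {Q : Type*} [MetricSpace Q] (hQ : IsHadamard Q)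
    (k : ℕ) (y z p q : Q) :
    dist y q ^ 2 - dist y p ^ 2 - dist z q ^ 2 + dist z p ^ 2 ≤
      2 ^ k * dist p q ^ 2 + dist y z ^ 2 / 2 ^ k := by
  induction k generalizing y z with
  | zero => simpa using hQ.sq_quadruple_le_add y z p q
  | succ k ih =>
    obtain ⟨w, h1, h2⟩ := hQ.exists_midpoint y z
    have i1 := ih y w
    have i2 := ih w z
    have j1 : dist y w ^ 2 / 2 ^ k ≤ (dist y z / 2) ^ 2 / 2 ^ k := by gcongr
    have j2 : dist w z ^ 2 / 2 ^ k ≤ (dist y z / 2) ^ 2 / 2 ^ k := by gcongr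
    have e : (dist y z / 2) ^ 2 / 2 ^ k + (dist y z / 2) ^ 2 / 2 ^ k =
        dist y z ^ 2 / 2 ^ (k + 1) := by
      rw [pow_succ]; field_simp; ring
    have e2 : (2 : ℝ) ^ (k + 1) * dist p q ^ 2 =
      2 ^ k * dist p q ^ 2 + 2 ^ k * dist p q ^ 2 := by ring
    linarith

/-- Choosing 2^k within a factor 2 of d(y,z)/d(p,q) balances the two terms, giving a product bound
with constant 1 + 2. -/
theorem IsHadamard.sq_quadruple_le {Q : Type*} [MetricSpace Q] (hQ : IsHadamard Q)
    {y z p q : Q} (h : dist p q ≤ dist y z) :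
    dist y q ^ 2 - dist y p ^ 2 - dist z q ^ 2 + dist z p ^ 2 ≤ 3 * (dist p q * dist y z) := by
  rcases eq_or_lt_of_le (dist_nonneg (x := p) (y := q)) with h0 | h0
  · have := dist_eq_zero.1 h0.symm
    subst this
    simp
  · obtain ⟨k, hk1, hk2⟩ := exists_nat_pow_near (x := dist y z / dist p q) (y := (2 : ℝ))
      ((one_le_div h0).2 h) (by norm_num)
    have h1 := hQ.sq_quadruple_le_two_pow k y z p q
    rw [le_div_iff₀ h0] at hk1
    rw [div_lt_iff₀ h0, pow_succ] at hk2
    have h2 : (2 : ℝ) ^ k * dist p q ^ 2 ≤ dist p q * dist y z := by nlinarith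
    have h3 : dist y z ^ 2 / 2 ^ k ≤ 2 * (dist p q * dist y z) := by
      rw [div_le_iff₀ (by positivity)]
      nlinarith [dist_nonneg (x := y) (y := z)]
    linarith

/-- With a = d(p,q) ≤ b = d(y,z): if all distances are of order b, pairing the terms and the mean
value bound suffice. Far away this would lose the decay of the derivative's variation, so the power
is linearized in the squared distance and the quadruple inequality for squares is used. -/
theorem IsHadamard.rpow_quadruple_le_of_le {Q : Type*} [MetricSpace Q] (hQ : IsHadamard Q)
    {α : ℝ} (hα : 1 < α) (hα2 : α ≤ 2) {y z p q : Q} (h : dist p q ≤ dist y z) :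
    dist y q ^ α - dist y p ^ α - dist z q ^ α + dist z p ^ α ≤
      24 * (dist p q * dist y z ^ (α - 1)) := by
  rcases eq_or_lt_of_le (dist_nonneg (x := y) (y := z)) with hb0 | hb0
  · have := dist_eq_zero.1 hb0.symm
    subst this
    have : 0 ≤ 24 * (dist p q * dist y y ^ (α - 1)) := by positivity
    linarith
  set a := dist p q with ha
  set b := dist y z with hb
  have ha0 : 0 ≤ a := dist_nonneg
  have t1 : dist y q ≤ dist y p + a := dist_triangle y p q
  have t2 : dist z p ≤ dist z q + a := by rw [ha, dist_comm p q]; exact dist_triangle z q p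
  have t3 : dist z p ≤ dist y p + b := by
    rw [hb, dist_comm y z, add_comm]; exact dist_triangle z y p
  have t4 : dist z q ≤ dist z p + a := dist_triangle z p q
  have t5 : dist y p ≤ b + dist z p := dist_triangle y z p
  rcases le_or_gt (dist y p) (4 * b) with hn | hf
  · have h1 := rpow_sub_rpow_le hα hα2 (dist_nonneg (x := y) (y := q))
      (dist_nonneg (x := y) (y := p)) (N := 6 * b) (a := a) (by linarith) ha0 (by linarith)
    have h2 := rpow_sub_rpow_le hα hα2 (dist_nonneg (x := z) (y := p))
      (dist_nonneg (x := z) (y := q)) (N := 6 * b) (a := a) (by linarith) ha0 (by linarith)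
    have h3 : (6 * b) ^ (α - 1) ≤ 6 * b ^ (α - 1) := by
      rw [Real.mul_rpow (by norm_num) hb0.le]
      gcongr
      calc (6 : ℝ) ^ (α - 1) ≤ 6 ^ (1 : ℝ) :=
            Real.rpow_le_rpow_of_exponent_le (by norm_num) (by linarith)
        _ = 6 := Real.rpow_one 6
    have := mul_le_mul_of_nonneg_left h3 ha0
    linarith
  · have hu : b ≤ dist y p := by linarith
    have hv : b ≤ dist z q := by linarith [dist_triangle_right z p q]
    -- The tangents are taken at the two distances with negative sign. Their slopes u^(α-2) and
    -- v^(α-2) differ; after splitting off the common slope u^(α-2), the remainder is (v^(α-2) -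
    -- u^(α-2))(t² - v²).
    have h1 := rpow_le_tangent_sq hα hα2 (hb0.trans_le hu) (dist_nonneg (x := y) (y := q))
    have h2 := rpow_le_tangent_sq hα hα2 (hb0.trans_le hv) (dist_nonneg (x := z) (y := p))
    have h3 := hQ.sq_quadruple_le h
    have h4 := rpow_sub_two_lipschitz hα hα2 hb0 hu hv
    have e : b ^ (α - 1) = b ^ (α - 2) * b := by
      rw [← Real.rpow_add_one hb0.ne']; ring_nf
    have hub : dist y p ^ (α - 2) ≤ b ^ (α - 2) :=
      Real.rpow_le_rpow_of_nonpos hb0 hu (by linarith)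
    have hbp : 0 ≤ b ^ (α - 2) := by positivity
    have hup : 0 ≤ dist y p ^ (α - 2) := by positivity
    set u := dist y p
    set v := dist z q
    set s := dist y q
    set t := dist z p
    have hs : 0 ≤ t := dist_nonneg
    have huv : |u - v| ≤ 2 * b := by rw [abs_le]; constructor <;> linarith
    have htv : |t ^ 2 - v ^ 2| ≤ 3 * a * max u v := by
      have : t ^ 2 - v ^ 2 = (t - v) * (t + v) := by ring
      rw [this, abs_mul]
      have i1 : |t - v| ≤ a := by rw [abs_le]; constructor <;> linarith
      have i2 : |t + v| ≤ 3 * max u v := by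
        rw [abs_of_nonneg (by linarith)]
        linarith [le_max_right u v]
      calc |t - v| * |t + v| ≤ a * (3 * max u v) := by gcongr
        _ = _ := by ring
    have h5 : (v ^ (α - 2) - u ^ (α - 2)) * (t ^ 2 - v ^ 2) ≤ 6 * a * (b ^ (α - 2) * b) := by
      calc _ ≤ |(v ^ (α - 2) - u ^ (α - 2)) * (t ^ 2 - v ^ 2)| := le_abs_self _
        _ = |v ^ (α - 2) - u ^ (α - 2)| * |t ^ 2 - v ^ 2| := abs_mul _ _
        _ ≤ |v ^ (α - 2) - u ^ (α - 2)| * (3 * a * max u v) := by gcongr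
        _ = 3 * a * (|v ^ (α - 2) - u ^ (α - 2)| * max u v) := by ring
        _ ≤ 3 * a * (b ^ (α - 2) * |u - v|) := by gcongr
        _ ≤ 3 * a * (b ^ (α - 2) * (2 * b)) := by gcongr
        _ = _ := by ring
    have h6 : u ^ (α - 2) * (s ^ 2 - u ^ 2 - v ^ 2 + t ^ 2) ≤ 3 * a * (b ^ (α - 2) * b) := by
      calc _ ≤ u ^ (α - 2) * (3 * (a * b)) := by gcongr
        _ ≤ b ^ (α - 2) * (3 * (a * b)) := by gcongr
        _ = _ := by ring
    have h7 : 0 ≤ a * (b ^ (α - 2) * b) := by positivity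
    rw [e]
    calc s ^ α - u ^ α - v ^ α + t ^ α
        ≤ α / 2 * (u ^ (α - 2) * (s ^ 2 - u ^ 2 - v ^ 2 + t ^ 2) +
          (v ^ (α - 2) - u ^ (α - 2)) * (t ^ 2 - v ^ 2)) := by linarith
      _ ≤ α / 2 * (9 * (a * (b ^ (α - 2) * b))) := by gcongr; linarith
      _ ≤ 24 * (a * (b ^ (α - 2) * b)) := by nlinarith

/-- Quadruple inequality for powers of the distance in a Hadamard space. -/
theorem IsHadamard.rpow_quadruple_le {Q : Type*} [MetricSpace Q] (hQ : IsHadamard Q)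
    {α : ℝ} (hα : 1 < α) (hα2 : α ≤ 2) (y z p q : Q) :
    dist y q ^ α - dist y p ^ α - dist z q ^ α + dist z p ^ α ≤
      24 * (dist p q * dist y z ^ (α - 1)) := by
  -- To drop d(p,q) ≤ d(y,z), the segment pq is bisected: the left side telescopes and the right
  -- side is linear in d(p,q), so the constant does not grow.
  have key : ∀ k : ℕ, ∀ p q : Q, dist p q ≤ 2 ^ k * dist y z →
      dist y q ^ α - dist y p ^ α - dist z q ^ α + dist z p ^ α ≤
        24 * (dist p q * dist y z ^ (α - 1)) := by
    intro k
    induction k with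
    | zero => intro p q h; exact hQ.rpow_quadruple_le_of_le hα hα2 (by simpa using h)
    | succ k ih =>
      intro p q h
      obtain ⟨w, h1, h2⟩ := hQ.exists_midpoint p q
      rw [pow_succ] at h
      have i1 := ih p w (by linarith)
      have i2 := ih w q (by linarith)
      have h3 : 0 ≤ dist y z ^ (α - 1) := by positivity
      have h4 := mul_le_mul_of_nonneg_right (show dist p w + dist w q ≤ dist p q by linarith) h3
      linarith
  rcases eq_or_lt_of_le (dist_nonneg (x := y) (y := z)) with hb0 | hb0
  · have := dist_eq_zero.1 hb0.symm
    subst this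
    have : 0 ≤ 24 * (dist p q * dist y y ^ (α - 1)) := by positivity
    linarith
  · obtain ⟨k, hk⟩ := pow_unbounded_of_one_lt (dist p q / dist y z) (one_lt_two : (1 : ℝ) < 2)
    exact key k p q ((div_lt_iff₀ hb0).1 hk).le

/-! ### Uniform convexity along midpoints and existence of sample means. -/

theorem add_rpow_le_two_mul {α x y : ℝ} (hα : 1 < α) (hα2 : α ≤ 2) (hx : 0 ≤ x) (hy : 0 ≤ y) :
    (x + y) ^ α ≤ 2 * (x ^ α + y ^ α) := by
  have h := rpow_midpoint_le hα hα2 hx hy (le_max_left x y) (le_max_right x y)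
  have h0 : 0 ≤ α * (α - 1) / 8 * (x - y) ^ 2 * max x y ^ (α - 2) := by
    have : 0 ≤ max x y := hx.trans (le_max_left x y)
    have : 0 ≤ α * (α - 1) := by nlinarith
    positivity
  have h4 : (2 : ℝ) ^ α ≤ 4 := by
    calc (2 : ℝ) ^ α ≤ 2 ^ (2 : ℝ) := Real.rpow_le_rpow_of_exponent_le (by norm_num) hα2
      _ = 4 := by norm_num
  calc (x + y) ^ α = 2 ^ α * ((x + y) / 2) ^ α := by
        rw [← Real.mul_rpow (by norm_num) (by positivity)]; congr 1; ring
    _ ≤ 4 * ((x ^ α + y ^ α) / 2) := by gcongr; linarith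
    _ = _ := by ring

theorem dist_rpow_le {Q : Type*} [MetricSpace Q] {α : ℝ} (hα : 1 < α) (hα2 : α ≤ 2)
    (x y z : Q) : dist x z ^ α ≤ 2 * (dist x y ^ α + dist y z ^ α) :=
  (Real.rpow_le_rpow dist_nonneg (dist_triangle x y z) (by linarith)).trans
    (add_rpow_le_two_mul hα hα2 dist_nonneg dist_nonneg)

/-- Midpoints satisfy a uniform convexity inequality for all powers of the distance. -/
theorem IsHadamard.exists_rpow_midpoint {Q : Type*} [MetricSpace Q] (hQ : IsHadamard Q)
    {α : ℝ} (hα : 1 < α) (hα2 : α ≤ 2) (p q : Q) :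
    ∃ w : Q, ∀ (y : Q) (M : ℝ), dist y p ≤ M → dist y q ≤ M →
      dist y w ^ α ≤
        (dist y p ^ α + dist y q ^ α) / 2 - α * (α - 1) / 8 * dist p q ^ 2 * M ^ (α - 2) := by
  obtain ⟨w, hw⟩ := hQ.midpoint p q
  refine ⟨w, fun y M hp hq => rpow_le_of_sq_le hα hα2 dist_nonneg dist_nonneg dist_nonneg hp hq
    ?_ ?_⟩
  · rw [dist_comm y p, dist_comm y q]; exact abs_dist_sub_le p q y
  · rw [dist_comm y p, dist_comm y q]; exact hw y

theorem IsSamplePowerFrechetMean.sum_le {Q : Type*} [MetricSpace Q] {n : ℕ} {α : ℝ}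
    {y : Fin n → Q} {p : Q} (h : IsSamplePowerFrechetMean α y p) (q : Q) :
    ∑ i, dist (y i) p ^ α ≤ ∑ i, dist (y i) q ^ α :=
  isMinOn_iff.1 h q (mem_univ q)

/-- A sample mean is not farther from `m` than the sample is, in `α`-th mean. -/
theorem IsSamplePowerFrechetMean.mul_dist_rpow_le {Q : Type*} [MetricSpace Q] {n : ℕ} {α : ℝ}
    (hα : 1 < α) (hα2 : α ≤ 2) {y : Fin n → Q} {p : Q}
    (h : IsSamplePowerFrechetMean α y p) (m : Q) :
    n * dist p m ^ α ≤ 4 * ∑ i, dist (y i) m ^ α := by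
  have h1 : ∑ _i : Fin n, dist p m ^ α ≤
      ∑ i, 2 * (dist (y i) p ^ α + dist (y i) m ^ α) := by
    refine Finset.sum_le_sum fun i _ => ?_
    have := dist_rpow_le hα hα2 p (y i) m
    rwa [dist_comm p (y i)] at this
  rw [Finset.sum_const, Finset.card_univ, Fintype.card_fin, nsmul_eq_mul, ← Finset.mul_sum,
    Finset.sum_add_distrib] at h1
  linarith [h.sum_le m]

/-- Closed balls need not be compact, so uniform convexity does the work: near-minimizers stay
within a common distance of the data, and the midpoint of two that are far apart would undercut the
infimum. Minimizing sequences are therefore Cauchy. -/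
theorem IsHadamard.exists_isSamplePowerFrechetMean {Q : Type*} [MetricSpace Q]
    (hQ : IsHadamard Q) {n : ℕ} (hn : 1 ≤ n) {α : ℝ} (hα : 1 < α) (hα2 : α ≤ 2)
    (y : Fin n → Q) : ∃ p, IsSamplePowerFrechetMean α y p := by
  have := hQ.nonempty
  have := hQ.complete
  set G : Q → ℝ := fun q => ∑ i, dist (y i) q ^ α with hG
  have hG0 : ∀ q, 0 ≤ G q := fun q => Finset.sum_nonneg fun i _ => by positivity
  have hbdd : BddBelow (range G) := ⟨0, by rintro _ ⟨q, rfl⟩; exact hG0 q⟩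
  have hI : ∀ q, iInf G ≤ G q := fun q => ciInf_le hbdd q
  have hI0 : 0 ≤ iInf G := le_ciInf hG0
  have hex : ∀ k : ℕ, ∃ q, G q < iInf G + 1 / ((k : ℝ) + 1) := fun k =>
    exists_lt_of_ciInf_lt (lt_add_of_pos_right _ Nat.one_div_pos_of_nat)
  choose u hu using hex
  set M : ℝ := (iInf G + 1) ^ (1 / α) with hM
  have hMpos : 0 < M := by positivity
  have hle : ∀ k i, dist (y i) (u k) ≤ M := by
    intro k i
    have h1 : dist (y i) (u k) ^ α ≤ iInf G + 1 := by
      calc dist (y i) (u k) ^ α ≤ G (u k) :=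
            Finset.single_le_sum (f := fun i => dist (y i) (u k) ^ α)
              (fun j _ => by positivity) (Finset.mem_univ i)
        _ ≤ iInf G + 1 / ((k : ℝ) + 1) := (hu k).le
        _ ≤ iInf G + 1 := by
            gcongr
            rw [div_le_one (by positivity)]
            linarith [Nat.cast_nonneg (α := ℝ) k]
    rw [hM, one_div, Real.le_rpow_inv_iff_of_pos dist_nonneg (by positivity) (by linarith)]
    exact h1
  set D : ℝ := α * (α - 1) / 8 * M ^ (α - 2) with hD
  have hDpos : 0 < D := by
    have : 0 < α * (α - 1) := by nlinarith
    positivity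
  have hsq : ∀ N k l : ℕ, N ≤ k → N ≤ l →
      dist (u k) (u l) ≤ Real.sqrt (1 / ((N : ℝ) + 1) / D) := by
    intro N k l hk hl
    apply Real.le_sqrt_of_sq_le
    rw [le_div_iff₀ hDpos]
    obtain ⟨w, hw⟩ := hQ.exists_rpow_midpoint hα hα2 (u k) (u l)
    have h1 : G w ≤ (G (u k) + G (u l)) / 2 - n * (dist (u k) (u l) ^ 2 * D) := by
      have : ∑ i, dist (y i) w ^ α ≤ ∑ i, ((dist (y i) (u k) ^ α + dist (y i) (u l) ^ α) / 2 -
          α * (α - 1) / 8 * dist (u k) (u l) ^ 2 * M ^ (α - 2)) :=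
        Finset.sum_le_sum fun i _ => hw (y i) M (hle k i) (hle l i)
      rw [Finset.sum_sub_distrib, ← Finset.sum_div, Finset.sum_add_distrib, Finset.sum_const,
        Finset.card_univ, Fintype.card_fin, nsmul_eq_mul] at this
      simp only [hG, hD]
      linarith
    have hn' : (1 : ℝ) ≤ n := by exact_mod_cast hn
    have h2 : dist (u k) (u l) ^ 2 * D ≤ n * (dist (u k) (u l) ^ 2 * D) :=
      le_mul_of_one_le_left (by positivity) hn'
    have h3 : 1 / ((k : ℝ) + 1) ≤ 1 / ((N : ℝ) + 1) := by gcongr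
    have h4 : 1 / ((l : ℝ) + 1) ≤ 1 / ((N : ℝ) + 1) := by gcongr
    linarith [hI w, hu k, hu l]
  have hlim : Tendsto (fun N : ℕ => Real.sqrt (1 / ((N : ℝ) + 1) / D)) atTop (nhds 0) := by
    have := (Real.continuous_sqrt.tendsto (0 / D)).comp
      ((tendsto_one_div_add_atTop_nhds_zero_nat (𝕜 := ℝ)).div_const D)
    simpa [Function.comp_def] using this
  have hc : CauchySeq u := cauchySeq_of_le_tendsto_0 _
    (fun k l N hk hl => hsq N k l hk hl) hlim
  obtain ⟨p, hp⟩ := cauchySeq_tendsto_of_complete hc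
  refine ⟨p, isMinOn_iff.2 fun q _ => ?_⟩
  have hGc : Continuous G := by
    refine continuous_finsetSum _ fun i _ => ?_
    exact (continuous_const.dist continuous_id).rpow_const fun _ => Or.inr (by linarith)
  have h1 : Tendsto (fun k => G (u k)) atTop (nhds (G p)) := (hGc.tendsto p).comp hp
  have h2 : Tendsto (fun k : ℕ => iInf G + 1 / ((k : ℝ) + 1)) atTop (nhds (iInf G)) := by
    simpa using (tendsto_one_div_add_atTop_nhds_zero_nat (𝕜 := ℝ)).const_add (iInf G)
  exact (le_of_tendsto_of_tendsto' h1 h2 fun k => (hu k).le).trans (hI q)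

/-! ### Stability, uniqueness and continuity of sample means. -/

/-- A linear minorant of the weight, whose sum replaces Jensen's inequality at the cost of a factor
1/2. For x > r it follows from (x/r)^(α-2) ≥ r/x ≥ 1 - x/(2r). -/
theorem rpow_sub_two_ge_linear {α x r : ℝ} (hα : 1 < α) (hα2 : α ≤ 2) (hx : 0 < x)
    (hr : 0 < r) : r ^ (α - 2) * (1 - x / (2 * r)) ≤ x ^ (α - 2) := by
  have hr' : 0 < r ^ (α - 2) := by positivity
  rcases le_or_gt x r with h | h
  · have h1 : r ^ (α - 2) ≤ x ^ (α - 2) := Real.rpow_le_rpow_of_nonpos hx h (by linarith)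
    have h2 : 0 ≤ x / (2 * r) := by positivity
    nlinarith
  · have h1 : (x / r) ^ (-1 : ℝ) ≤ (x / r) ^ (α - 2) :=
      Real.rpow_le_rpow_of_exponent_le ((one_le_div hr).2 h.le) (by linarith)
    rw [Real.rpow_neg_one, Real.div_rpow hx.le hr.le, le_div_iff₀ hr', inv_div] at h1
    refine le_trans ?_ h1
    rw [mul_comm]
    gcongr
    rw [le_div_iff₀ hx, sub_mul, div_mul_eq_mul_div, sub_le_iff_le_add, ← sub_le_iff_le_add',
      le_div_iff₀ (by positivity)]
    nlinarith [sq_nonneg (x - r)]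

/-- A lower bound for power sums with exponent in `(-1, 0]` by the power of the mean. -/
theorem sum_rpow_sub_two_ge {n : ℕ} {α r : ℝ} (hα : 1 < α) (hα2 : α ≤ 2)
    {x : Fin n → ℝ} (hx : ∀ i, 0 < x i) (hr : 0 < r) (hsum : ∑ i, x i ≤ n * r) :
    n / 2 * r ^ (α - 2) ≤ ∑ i, x i ^ (α - 2) := by
  have h : ∑ i, r ^ (α - 2) * (1 - x i / (2 * r)) ≤ ∑ i, x i ^ (α - 2) :=
    Finset.sum_le_sum fun i _ => rpow_sub_two_ge_linear hα hα2 (hx i) hr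
  refine le_trans ?_ h
  rw [← Finset.mul_sum, Finset.sum_sub_distrib, ← Finset.sum_div, mul_comm]
  gcongr
  simp only [Finset.sum_const, Finset.card_univ, Fintype.card_fin, nsmul_eq_mul, mul_one]
  have : (∑ i, x i) / (2 * r) ≤ n / 2 := by
    rw [div_le_iff₀ (by positivity)]; linarith
  linarith

/-- Stability of sample means: two samples that are close have sample means that are close. -/
theorem IsHadamard.sample_stability {Q : Type*} [MetricSpace Q] (hQ : IsHadamard Q)
    {n : ℕ} (hn : 1 ≤ n) {α : ℝ} (hα : 1 < α) (hα2 : α ≤ 2) {y y' : Fin n → Q} {p q : Q}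
    (hp : IsSamplePowerFrechetMean α y p) (hq : IsSamplePowerFrechetMean α y' q) (m : Q) :
    α * (α - 1) / 8 * (n * dist p q) ≤
      24 * ((∑ i, dist (y i) m) / n + dist p m + dist q m) ^ (2 - α) *
        ∑ i, dist (y i) (y' i) ^ (α - 1) := by
  have hn' : (0 : ℝ) < n := by exact_mod_cast hn
  have hκ : 0 < α * (α - 1) := by nlinarith
  set R : ℝ := (∑ i, dist (y i) m) / n + dist p m + dist q m with hR
  have hS : 0 ≤ (∑ i, dist (y i) m) / n :=
    div_nonneg (Finset.sum_nonneg fun i _ => dist_nonneg) hn'.le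
  rcases eq_or_lt_of_le (dist_nonneg (x := p) (y := q)) with h0 | h0
  · rw [← h0]
    have : 0 ≤ R := by positivity
    simp only [mul_zero]
    positivity
  have he : 0 < dist p m + dist q m := h0.trans_le (dist_triangle_right p q m)
  have hRpos : 0 < R := by linarith
  obtain ⟨w, hw⟩ := hQ.exists_rpow_midpoint hα hα2 p q
  -- A separate radius for each observation, so that only their average `R`, and no maximum over the
  -- sample, enters the bound.
  set x : Fin n → ℝ := fun i => dist (y i) m + (dist p m + dist q m) with hx
  have hx0 : ∀ i, 0 < x i := fun i => by
    have := dist_nonneg (x := y i) (y := m)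
    simp only [hx]; linarith
  have h1 : ∑ i, dist (y i) w ^ α ≤ ∑ i, ((dist (y i) p ^ α + dist (y i) q ^ α) / 2 -
      α * (α - 1) / 8 * dist p q ^ 2 * x i ^ (α - 2)) := by
    refine Finset.sum_le_sum fun i _ => hw (y i) (x i) ?_ ?_
    · have := dist_triangle_right (y i) p m
      have := dist_nonneg (x := q) (y := m)
      simp only [hx]; linarith
    · have := dist_triangle_right (y i) q m
      have := dist_nonneg (x := p) (y := m)
      simp only [hx]; linarith
  rw [Finset.sum_sub_distrib, ← Finset.sum_div, Finset.sum_add_distrib, ← Finset.mul_sum] at h1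
  have h2 : n / 2 * R ^ (α - 2) ≤ ∑ i, x i ^ (α - 2) := by
    refine sum_rpow_sub_two_ge hα hα2 hx0 hRpos (le_of_eq ?_)
    simp only [hx, hR, Finset.sum_add_distrib, Finset.sum_const, Finset.card_univ,
      Fintype.card_fin, nsmul_eq_mul]
    field_simp
    ring
  -- Optimality of q for y' allows its loss difference to be subtracted for free, which creates a
  -- sum of quadruples. The bound is linear in d(p,q), so one factor cancels against the quadratic
  -- gain.
  have h3 : ∑ i, (dist (y i) q ^ α - dist (y i) p ^ α - dist (y' i) q ^ α +
      dist (y' i) p ^ α) ≤ ∑ i, 24 * (dist p q * dist (y i) (y' i) ^ (α - 1)) :=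
    Finset.sum_le_sum fun i _ => hQ.rpow_quadruple_le hα hα2 (y i) (y' i) p q
  simp only [Finset.sum_add_distrib, Finset.sum_sub_distrib, ← Finset.mul_sum] at h3
  have h4 := hp.sum_le w
  have h5 := hq.sum_le p
  have h6 := mul_le_mul_of_nonneg_left h2 (show 0 ≤ α * (α - 1) / 8 * dist p q ^ 2 by positivity)
  have h7 : dist p q * (α * (α - 1) / 8 * (n * dist p q) * R ^ (α - 2)) ≤
      dist p q * (24 * ∑ i, dist (y i) (y' i) ^ (α - 1)) := by linarith
  have h8 := le_of_mul_le_mul_left h7 h0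
  have h9 : R ^ (2 - α) * R ^ (α - 2) = 1 := by
    rw [← Real.rpow_add hRpos]; norm_num
  have h10 := mul_le_mul_of_nonneg_left h8 (show 0 ≤ R ^ (2 - α) by positivity)
  calc α * (α - 1) / 8 * (n * dist p q)
      = (R ^ (2 - α) * R ^ (α - 2)) * (α * (α - 1) / 8 * (n * dist p q)) := by rw [h9, one_mul]
    _ ≤ _ := by linarith

theorem IsSamplePowerFrechetMean.unique {Q : Type*} [MetricSpace Q] (hQ : IsHadamard Q)
    {n : ℕ} (hn : 1 ≤ n) {α : ℝ} (hα : 1 < α) (hα2 : α ≤ 2) {y : Fin n → Q} {p q : Q}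
    (hp : IsSamplePowerFrechetMean α y p) (hq : IsSamplePowerFrechetMean α y q) : p = q := by
  have h := hQ.sample_stability hn hα hα2 hp hq p
  have h0 : ∑ i, dist (y i) (y i) ^ (α - 1) = 0 :=
    Finset.sum_eq_zero fun i _ => by rw [dist_self, Real.zero_rpow (by linarith)]
  rw [h0, mul_zero] at h
  have hn' : (0 : ℝ) < n := by exact_mod_cast hn
  have hκ : 0 < α * (α - 1) := by nlinarith
  by_contra hne
  have : 0 < dist p q := dist_pos.2 hne
  have : 0 < α * (α - 1) / 8 * (n * dist p q) := by positivity
  linarith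

/-- Supplies the measurability of the estimator. Stability at y, with the prefactor dominated by a
function continuous in y', squeezes the distance to zero. -/
theorem IsSamplePowerFrechetMean.continuous {Q : Type*} [MetricSpace Q] (hQ : IsHadamard Q)
    {n : ℕ} (hn : 1 ≤ n) {α : ℝ} (hα : 1 < α) (hα2 : α ≤ 2) {T : (Fin n → Q) → Q}
    (hT : ∀ y, IsSamplePowerFrechetMean α y (T y)) : Continuous T := by
  have hn' : (0 : ℝ) < n := by exact_mod_cast hn
  have hκ : 0 < α * (α - 1) / 8 * n := by
    have : 0 < α * (α - 1) := by nlinarith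
    positivity
  rw [continuous_iff_continuousAt]
  intro y
  rw [ContinuousAt, tendsto_iff_dist_tendsto_zero]
  set m := T y with hm
  set B : (Fin n → Q) → ℝ := fun y' =>
    (∑ i, dist (y i) m) / n + (4 * (∑ i, dist (y' i) m ^ α) / n) ^ (1 / α) with hB
  have hBc : Continuous B := by
    refine continuous_const.add (Continuous.rpow_const ?_ fun _ => Or.inr (by positivity))
    refine (continuous_const.mul (continuous_finsetSum _ fun i _ => ?_)).div_const _
    exact ((continuous_apply i).dist continuous_const).rpow_const
      fun _ => Or.inr (by linarith)
  have hSc : Continuous fun y' : Fin n → Q => ∑ i, dist (y i) (y' i) ^ (α - 1) :=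
    continuous_finsetSum _ fun i _ =>
      (continuous_const.dist (continuous_apply i)).rpow_const fun _ => Or.inr (by linarith)
  have hlim : Tendsto (fun y' : Fin n → Q =>
      24 * B y' ^ (2 - α) * (∑ i, dist (y i) (y' i) ^ (α - 1)) / (α * (α - 1) / 8 * n))
      (nhds y) (nhds 0) := by
    have hc : Continuous fun y' : Fin n → Q =>
        24 * B y' ^ (2 - α) * (∑ i, dist (y i) (y' i) ^ (α - 1)) / (α * (α - 1) / 8 * n) :=
      ((continuous_const.mul (hBc.rpow_const fun _ => Or.inr (by linarith))).mul hSc).div_const _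
    have := hc.tendsto y
    have h0 : ∑ i, dist (y i) (y i) ^ (α - 1) = 0 :=
      Finset.sum_eq_zero fun i _ => by rw [dist_self, Real.zero_rpow (by linarith)]
    rwa [h0, mul_zero, zero_div] at this
  refine squeeze_zero (fun _ => dist_nonneg) (fun y' => ?_) hlim
  rw [le_div_iff₀ hκ]
  have h := hQ.sample_stability hn hα hα2 (hT y) (hT y') m
  rw [← hm, dist_self, dist_comm] at h
  have h1 : dist (T y') m ≤ (4 * (∑ i, dist (y' i) m ^ α) / n) ^ (1 / α) := by
    rw [one_div, Real.le_rpow_inv_iff_of_pos dist_nonneg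
      (div_nonneg (mul_nonneg (by norm_num) (Finset.sum_nonneg fun i _ => by positivity)) hn'.le)
      (by linarith), le_div_iff₀ hn', mul_comm]
    exact (hT y').mul_dist_rpow_le hα hα2 m
  have h2 : (∑ i, dist (y i) m) / n + 0 + dist (T y') m ≤ B y' := by
    simp only [hB]; linarith
  have h0 : 0 ≤ (∑ i, dist (y i) m) / n + 0 + dist (T y') m := by
    have : 0 ≤ ∑ i, dist (y i) m := Finset.sum_nonneg fun i _ => dist_nonneg
    positivity
  have h3 : ((∑ i, dist (y i) m) / n + 0 + dist (T y') m) ^ (2 - α) ≤ B y' ^ (2 - α) :=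
    Real.rpow_le_rpow h0 h2 (by linarith)
  have h4 : 0 ≤ ∑ i, dist (y i) (y' i) ^ (α - 1) := Finset.sum_nonneg fun i _ => by positivity
  have h5 := mul_le_mul_of_nonneg_right h3 h4
  linarith

/-! ### Replacing one observation. -/

/-- The exponents add up to (2 - α) + 2(α - 1) = α, so the product is at most max(b, r)^α. This is
why α-th moments suffice. -/
theorem rpow_mul_sq_rpow_le_add {α b r : ℝ} (hα : 1 < α) (hα2 : α ≤ 2) (hb : 0 ≤ b)
    (hr : 0 ≤ r) : r ^ (2 - α) * (b ^ (α - 1) * b ^ (α - 1)) ≤ b ^ α + r ^ α := by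
  have key : ∀ M : ℝ, b ≤ M → r ≤ M →
      r ^ (2 - α) * (b ^ (α - 1) * b ^ (α - 1)) ≤ M ^ α := by
    intro M hbM hrM
    have hM : 0 ≤ M := hb.trans hbM
    have h1 : b ^ (α - 1) ≤ M ^ (α - 1) := Real.rpow_le_rpow hb hbM (by linarith)
    have h2 : r ^ (2 - α) ≤ M ^ (2 - α) := Real.rpow_le_rpow hr hrM (by linarith)
    calc r ^ (2 - α) * (b ^ (α - 1) * b ^ (α - 1))
        ≤ M ^ (2 - α) * (M ^ (α - 1) * M ^ (α - 1)) := by gcongr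
      _ = M ^ α := by
        rw [← Real.rpow_add_of_nonneg hM (by linarith) (by linarith),
          ← Real.rpow_add_of_nonneg hM (by linarith) (by linarith)]
        congr 1; ring
  have hb' : 0 ≤ b ^ α := by positivity
  have hr' : 0 ≤ r ^ α := by positivity
  rcases le_total b r with h | h
  · linarith [key r h le_rfl]
  · linarith [key b le_rfl h]

theorem mean_rpow_le {n : ℕ} (hn : 1 ≤ n) {α : ℝ} (hα : 1 ≤ α) {x : Fin n → ℝ}
    (hx : ∀ i, 0 ≤ x i) : ((∑ i, x i) / n) ^ α ≤ (∑ i, x i ^ α) / n := by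
  have hn' : (0 : ℝ) < n := by exact_mod_cast hn
  have h := Real.rpow_arith_mean_le_arith_mean_rpow Finset.univ (fun _ : Fin n => 1 / (n : ℝ)) x
    (fun _ _ => by positivity) (by simp [hn'.ne']) (fun i _ => hx i) hα
  simp only [← Finset.mul_sum] at h
  rwa [one_div, inv_mul_eq_div, inv_mul_eq_div] at h

/-- Effect of replacing a single observation on the losses at the sample mean. -/
theorem IsHadamard.replace_one_le {Q : Type*} [MetricSpace Q] (hQ : IsHadamard Q)
    {n : ℕ} (hn : 1 ≤ n) {α : ℝ} (hα : 1 < α) (hα2 : α ≤ 2) {y y' : Fin n → Q} {p q : Q}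
    (hp : IsSamplePowerFrechetMean α y p) (hq : IsSamplePowerFrechetMean α y' q) (m : Q)
    (i : Fin n) (hi : ∀ j, j ≠ i → y j = y' j) :
    α * (α - 1) / 8 * n *
      (dist (y' i) p ^ α - dist (y i) p ^ α - dist (y' i) q ^ α + dist (y i) q ^ α) ≤
      11520 * (dist (y i) m ^ α + dist (y' i) m ^ α + (∑ j, dist (y j) m ^ α) / n +
        (∑ j, dist (y' j) m ^ α) / n) := by
  have hn' : (0 : ℝ) < n := by exact_mod_cast hn
  have hκ : 0 < α * (α - 1) / 8 * n := by
    have : 0 < α * (α - 1) := by nlinarith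
    positivity
  have h1 := hQ.rpow_quadruple_le hα hα2 (y i) (y' i) p q
  have h2 := hQ.sample_stability hn hα hα2 hp hq m
  have hs : ∑ j, dist (y j) (y' j) ^ (α - 1) = dist (y i) (y' i) ^ (α - 1) := by
    refine Finset.sum_eq_single i (fun j _ hj => ?_) (by simp)
    rw [hi j hj, dist_self, Real.zero_rpow (by linarith)]
  rw [hs] at h2
  have hx1 : 0 ≤ (∑ j, dist (y j) m) / n :=
    div_nonneg (Finset.sum_nonneg fun _ _ => dist_nonneg) hn'.le
  have e1 := mean_rpow_le hn hα.le (x := fun j => dist (y j) m) fun _ => dist_nonneg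
  have e2 : dist p m ^ α ≤ 4 * ((∑ j, dist (y j) m ^ α) / n) := by
    rw [← mul_div_assoc, le_div_iff₀ hn', mul_comm]; exact hp.mul_dist_rpow_le hα hα2 m
  have e3 : dist q m ^ α ≤ 4 * ((∑ j, dist (y' j) m ^ α) / n) := by
    rw [← mul_div_assoc, le_div_iff₀ hn', mul_comm]; exact hq.mul_dist_rpow_le hα hα2 m
  have e4 : dist (y i) (y' i) ^ α ≤ 2 * (dist (y i) m ^ α + dist (y' i) m ^ α) := by
    have := dist_rpow_le hα hα2 (y i) m (y' i)
    rwa [dist_comm m] at this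
  set x := (∑ j, dist (y j) m) / n
  have hpm : 0 ≤ dist p m := dist_nonneg
  have hqm : 0 ≤ dist q m := dist_nonneg
  have e5 := add_rpow_le_two_mul hα hα2 (add_nonneg hx1 hpm) hqm
  have e6 := add_rpow_le_two_mul hα hα2 hx1 hpm
  have e7 := rpow_mul_sq_rpow_le_add hα hα2 (dist_nonneg (x := y i) (y := y' i))
    (add_nonneg (add_nonneg hx1 hpm) hqm)
  set R := x + dist p m + dist q m
  set A := (∑ j, dist (y j) m ^ α) / n
  set A' := (∑ j, dist (y' j) m ^ α) / n
  have hA' : 0 ≤ A' := div_nonneg (Finset.sum_nonneg fun _ _ => by positivity) hn'.le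
  have h3 := mul_le_mul_of_nonneg_left h1 hκ.le
  have h4 := mul_le_mul_of_nonneg_right h2
    (show 0 ≤ 24 * dist (y i) (y' i) ^ (α - 1) by positivity)
  have l1 : 0 ≤ dist (y i) m ^ α := by positivity
  have l2 : 0 ≤ dist (y' i) m ^ α := by positivity
  calc α * (α - 1) / 8 * n *
        (dist (y' i) p ^ α - dist (y i) p ^ α - dist (y' i) q ^ α + dist (y i) q ^ α)
      = α * (α - 1) / 8 * n *
        (dist (y i) q ^ α - dist (y i) p ^ α - dist (y' i) q ^ α + dist (y' i) p ^ α) := by ring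
    -- 576 = 24²: one factor from the quadruple inequality, one from stability. The next bound has
    -- 11520 = 576 · 20, where 20 is the largest coefficient left after expanding R^α.
    _ ≤ 576 * (R ^ (2 - α) * (dist (y i) (y' i) ^ (α - 1) * dist (y i) (y' i) ^ (α - 1))) := by
        linarith
    _ ≤ _ := by linarith

/-! ### Expected excess risk by exchangeability. -/

theorem measurePreserving_comp_perm {ι X : Type*} [Fintype ι] [MeasurableSpace X]
    (μ : Measure X) [SigmaFinite μ] (σ : Equiv.Perm ι) :
    MeasurePreserving (fun y : ι → X => y ∘ σ) (Measure.pi fun _ => μ)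
      (Measure.pi fun _ => μ) := by
  have h := measurePreserving_piCongrLeft (fun _ : ι => μ) σ.symm
  convert h using 1
  ext y k
  obtain ⟨j, rfl⟩ := σ.symm.surjective k
  rw [MeasurableEquiv.coe_piCongrLeft, Equiv.piCongrLeft_apply_apply]
  simp

/-- Expected excess risk of the sample mean. -/
theorem IsHadamard.integral_excess_le {Q X : Type*} [MetricSpace Q] (hQ : IsHadamard Q)
    [TopologicalSpace X] [SecondCountableTopology X] [MeasurableSpace X] [OpensMeasurableSpace X]
    {ι : X → Q} (hι : Continuous ι) (μ : Measure X) [IsProbabilityMeasure μ]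
    {α : ℝ} (hα : 1 < α) (hα2 : α ≤ 2) (m : Q)
    (hmom : Integrable (fun x => dist (ι x) m ^ α) μ) {n : ℕ} (hn : 1 ≤ n)
    {T : (Fin n → Q) → Q} (hT : ∀ y, IsSamplePowerFrechetMean α y (T y)) :
    Integrable (fun y : Fin n → X => ∫ x, dist (ι x) (T (ι ∘ y)) ^ α ∂μ)
      (Measure.pi fun _ => μ) ∧
    α * (α - 1) / 8 * n * (∫ y : Fin n → X, ∫ x, dist (ι x) (T (ι ∘ y)) ^ α ∂μ
      ∂(Measure.pi fun _ => μ) - ∫ x, dist (ι x) m ^ α ∂μ) ≤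
      23040 * ∫ x, dist (ι x) m ^ α ∂μ := by
  have hn' : (0 : ℝ) < n := by exact_mod_cast hn
  have hκ : 0 < α * (α - 1) / 8 * n := by
    have : 0 < α * (α - 1) := by nlinarith
    positivity
  have hTc : Continuous T := IsSamplePowerFrechetMean.continuous hQ hn hα hα2 hT
  set V := ∫ x, dist (ι x) m ^ α ∂μ with hV
  -- Coordinate 0 is a fresh observation; coordinates 1 to n form the sample from which the mean is
  -- computed.
  set ν : Measure (Fin (n + 1) → X) := Measure.pi fun _ => μ with hν
  have hev : ∀ k, MeasurePreserving (Function.eval k) ν μ := fun k =>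
    measurePreserving_eval (fun _ : Fin (n + 1) => μ) k
  have hli : ∀ k, Integrable (fun Y : Fin (n + 1) → X => dist (ι (Y k)) m ^ α) ν := fun k =>
    (hev k).integrable_comp_of_integrable hmom
  have hlV : ∀ k, ∫ Y, dist (ι (Y k)) m ^ α ∂ν = V := fun k => by
    conv_rhs => rw [hV, ← (hev k).map_eq]
    rw [integral_map (hev k).aemeasurable]
    rw [(hev k).map_eq]; exact hmom.aestronglyMeasurable
  set h : Fin (n + 1) → (Fin (n + 1) → X) → ℝ :=
    fun k Y => dist (ι (Y k)) (T fun j => ι (Y j.succ)) ^ α with hh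
  have hc : ∀ k, Continuous (h k) := by
    intro k
    refine Continuous.rpow_const ?_ fun _ => Or.inr (by linarith)
    exact (hι.comp (continuous_apply k)).dist
      (hTc.comp (continuous_pi fun j => hι.comp (continuous_apply _)))
  have hhi : ∀ k, Integrable (h k) ν := by
    intro k
    have hb : Integrable (fun Y : Fin (n + 1) → X => 2 * dist (ι (Y k)) m ^ α +
        8 / n * ∑ j : Fin n, dist (ι (Y j.succ)) m ^ α) ν :=
      ((hli k).const_mul 2).add ((integrable_finsetSum _ fun j _ => hli j.succ).const_mul _)
    refine hb.mono' (hc k).measurable.aestronglyMeasurable (Eventually.of_forall fun Y => ?_)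
    simp only [hh]
    rw [Real.norm_of_nonneg (by positivity)]
    have h1 := dist_rpow_le hα hα2 (ι (Y k)) m (T fun j => ι (Y j.succ))
    have h2 := (hT fun j => ι (Y j.succ)).mul_dist_rpow_le hα hα2 m
    rw [dist_comm m] at h1
    rw [mul_comm, ← le_div_iff₀ hn'] at h2
    have : 8 / (n : ℝ) * ∑ j : Fin n, dist (ι (Y j.succ)) m ^ α =
      2 * (4 * (∑ j : Fin n, dist (ι (Y j.succ)) m ^ α) / n) := by ring
    linarith
  -- the first coordinate is independent of the others
  have hpres := measurePreserving_piFinSuccAbove (fun _ : Fin (n + 1) => μ) 0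
  set H : X × (Fin n → X) → ℝ := fun z => dist (ι z.1) (T (ι ∘ z.2)) ^ α with hH
  have hHh : H ∘ (MeasurableEquiv.piFinSuccAbove (fun _ : Fin (n + 1) => X) 0) = h 0 := by
    ext Y
    simp [hH, hh, MeasurableEquiv.piFinSuccAbove, Fin.tail, Function.comp_def]
  have hHi : Integrable H (μ.prod (Measure.pi fun _ : Fin n => μ)) := by
    rw [← hpres.integrable_comp_emb (MeasurableEquiv.measurableEmbedding _), hHh]
    exact hhi 0
  have hH0 : ∫ Y, h 0 Y ∂ν = ∫ y : Fin n → X, ∫ x, dist (ι x) (T (ι ∘ y)) ^ α ∂μ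
      ∂(Measure.pi fun _ => μ) := by
    have e1 : ∫ Y, h 0 Y ∂ν = ∫ z, H z ∂(μ.prod (Measure.pi fun _ : Fin n => μ)) := by
      rw [← hpres.integral_comp (MeasurableEquiv.measurableEmbedding _)]
      rw [← hHh]; rfl
    rw [e1, integral_prod_symm H hHi]
  refine ⟨hHi.integral_prod_right, ?_⟩
  rw [← hH0]
  -- Swapping 0 and i preserves `ν`, so the integrated second difference is twice the difference of
  -- the two losses. The right side integrates to 11520 · 4V, and halving gives 23040.
  have hswap : ∀ i : Fin n, α * (α - 1) / 8 * n * (∫ Y, h 0 Y ∂ν - ∫ Y, h i.succ Y ∂ν) ≤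
      23040 * V := by
    intro i
    set σ : Equiv.Perm (Fin (n + 1)) := Equiv.swap 0 i.succ with hσ
    have hS := measurePreserving_comp_perm μ σ
    have hSi : ∀ k, Integrable (fun Y => h k (Y ∘ σ)) ν := fun k =>
      hS.integrable_comp_of_integrable (hhi k)
    have hSe : ∀ k, ∫ Y, h k (Y ∘ σ) ∂ν = ∫ Y, h k Y ∂ν := fun k => by
      conv_rhs => rw [hν, ← hS.map_eq]
      rw [integral_map hS.aemeasurable]
      exact (hc k).measurable.aestronglyMeasurable
    have hpt : ∀ Y : Fin (n + 1) → X, α * (α - 1) / 8 * n *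
        (h 0 Y - h i.succ Y - h i.succ (Y ∘ σ) + h 0 (Y ∘ σ)) ≤
        11520 * (dist (ι (Y i.succ)) m ^ α + dist (ι (Y 0)) m ^ α +
          (∑ j : Fin n, dist (ι (Y j.succ)) m ^ α) / n +
          (∑ j : Fin n, dist (ι (Y (σ j.succ))) m ^ α) / n) := by
      intro Y
      have hr := hQ.replace_one_le hn hα hα2 (hT fun j => ι (Y j.succ))
        (hT fun j => ι (Y (σ j.succ))) m i (fun j hj => by
          rw [hσ, Equiv.swap_apply_of_ne_of_ne (Fin.succ_ne_zero j)
            (fun e => hj (Fin.succ_injective n e))])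
      have hσi : σ i.succ = 0 := Equiv.swap_apply_right _ _
      have hσ0 : σ 0 = i.succ := Equiv.swap_apply_left _ _
      simp only [hh, Function.comp_apply, hσ0, hσi] at hr ⊢
      exact hr
    have a1 : Integrable (fun Y => h 0 Y - h i.succ Y) ν := (hhi 0).sub (hhi i.succ)
    have a2 : Integrable (fun Y => h 0 Y - h i.succ Y - h i.succ (Y ∘ σ)) ν := a1.sub (hSi i.succ)
    have b1 : Integrable (fun Y : Fin (n + 1) → X =>
      dist (ι (Y i.succ)) m ^ α + dist (ι (Y 0)) m ^ α) ν := (hli i.succ).add (hli 0)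
    have b2 : Integrable (fun Y : Fin (n + 1) → X =>
        (∑ j : Fin n, dist (ι (Y j.succ)) m ^ α) / n) ν :=
      (integrable_finsetSum _ fun j _ => hli j.succ).div_const _
    have b3 : Integrable (fun Y : Fin (n + 1) → X => dist (ι (Y i.succ)) m ^ α +
      dist (ι (Y 0)) m ^ α + (∑ j : Fin n, dist (ι (Y j.succ)) m ^ α) / n) ν := b1.add b2
    have b4 : Integrable (fun Y : Fin (n + 1) → X =>
        (∑ j : Fin n, dist (ι (Y (σ j.succ))) m ^ α) / n) ν :=
      (integrable_finsetSum _ fun j _ => hli (σ j.succ)).div_const _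
    have hint := integral_mono ((a2.add (hSi 0)).const_mul (α * (α - 1) / 8 * n))
      ((b3.add b4).const_mul 11520) hpt
    rw [integral_const_mul, integral_const_mul, integral_add' a2 (hSi 0),
      integral_sub a1 (hSi i.succ), integral_sub (hhi 0) (hhi i.succ), hSe, hSe,
      integral_add' b3 b4, integral_add b1 b2, integral_add (hli i.succ) (hli 0),
      integral_div, integral_div,
      integral_finsetSum _ (fun (j : Fin n) _ => hli j.succ),
      integral_finsetSum _ (fun (j : Fin n) _ => hli (σ j.succ))] at hint
    simp only [hlV, Finset.sum_const, Finset.card_univ, Fintype.card_fin, nsmul_eq_mul] at hint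
    rw [mul_div_cancel_left₀ _ hn'.ne'] at hint
    linarith
  -- The only use of minimality against m: at the sample points, the fitted mean does no worse than
  -- m.
  have hmin : ∑ i : Fin n, ∫ Y, h i.succ Y ∂ν ≤ n * V := by
    rw [← integral_finsetSum _ fun (i : Fin n) _ => hhi i.succ]
    have := integral_mono (integrable_finsetSum Finset.univ fun (i : Fin n) _ => hhi i.succ)
      (integrable_finsetSum Finset.univ fun (j : Fin n) _ => hli j.succ)
      (fun Y => (hT fun j => ι (Y j.succ)).sum_le m)
    refine this.trans (le_of_eq ?_)
    rw [integral_finsetSum _ fun (j : Fin n) _ => hli j.succ]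
    simp [hlV]
  have hsum := Finset.sum_le_sum fun (i : Fin n) (_ : i ∈ Finset.univ) => hswap i
  rw [← Finset.mul_sum, Finset.sum_sub_distrib] at hsum
  simp only [Finset.sum_const, Finset.card_univ, Fintype.card_fin, nsmul_eq_mul] at hsum
  have h1 := mul_le_mul_of_nonneg_left hmin hκ.le
  refine le_of_mul_le_mul_left ?_ hn'
  linarith

/-! ### Variance inequality. -/

theorem integrable_dist_rpow {Q X : Type*} [MetricSpace Q] [TopologicalSpace X]
    [MeasurableSpace X] [OpensMeasurableSpace X] {ι : X → Q} (hι : Continuous ι) (μ : Measure X)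
    [IsFiniteMeasure μ] {α : ℝ} (hα : 1 < α) (hα2 : α ≤ 2) {m : Q}
    (hmom : Integrable (fun x => dist (ι x) m ^ α) μ) (q : Q) :
    Integrable (fun x => dist (ι x) q ^ α) μ := by
  have hc : Continuous fun x => dist (ι x) q ^ α :=
    (hι.dist continuous_const).rpow_const fun _ => Or.inr (by linarith)
  refine ((hmom.const_mul 2).add (integrable_const (2 * dist m q ^ α))).mono'
    hc.measurable.aestronglyMeasurable (Eventually.of_forall fun x => ?_)
  rw [Real.norm_of_nonneg (by positivity)]
  have := dist_rpow_le hα hα2 (ι x) m q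
  simp only [Pi.add_apply]
  linarith

/-- Variance inequality with a local mass term. -/
theorem IsHadamard.excess_ge_ball {Q X : Type*} [MetricSpace Q] (hQ : IsHadamard Q)
    [TopologicalSpace X] [MeasurableSpace X] [OpensMeasurableSpace X]
    {ι : X → Q} (hι : Continuous ι) (μ : Measure X) [IsFiniteMeasure μ]
    {α : ℝ} (hα : 1 < α) (hα2 : α ≤ 2) {m : Q}
    (hmom : Integrable (fun x => dist (ι x) m ^ α) μ)
    (hm : ∀ q, ∫ x, dist (ι x) m ^ α ∂μ ≤ ∫ x, dist (ι x) q ^ α ∂μ) (q : Q) (r : ℝ) :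
    α * (α - 1) / 4 * dist m q ^ 2 * (r + dist m q) ^ (α - 2) *
        μ.real {x | dist (ι x) m ≤ r} ≤
      ∫ x, dist (ι x) q ^ α ∂μ - ∫ x, dist (ι x) m ^ α ∂μ := by
  have hi := integrable_dist_rpow hι μ hα hα2 hmom
  obtain ⟨w, hw⟩ := hQ.exists_rpow_midpoint hα hα2 m q
  have hκ : 0 < α * (α - 1) := by nlinarith
  set s : Set X := {x | dist (ι x) m ≤ r} with hs
  have hsm : MeasurableSet s :=
    (isClosed_le (hι.dist continuous_const) continuous_const).measurableSet
  -- The convexity gain is kept only on the ball, where r + d(m,q) bounds both distances; elsewhere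
  -- it is discarded as nonnegative.
  set e : ℝ := α * (α - 1) / 8 * dist m q ^ 2 * (r + dist m q) ^ (α - 2) with he
  have hpt : ∀ x, dist (ι x) w ^ α + s.indicator (fun _ => e) x ≤
      (dist (ι x) m ^ α + dist (ι x) q ^ α) / 2 := by
    intro x
    by_cases hx : x ∈ s
    · rw [indicator_of_mem hx]
      have hx' : dist (ι x) m ≤ r := hx
      have := hw (ι x) (r + dist m q) (by linarith [dist_nonneg (x := m) (y := q)])
        (by linarith [dist_triangle (ι x) m q])
      linarith
    · rw [indicator_of_notMem hx]
      have h1 := hw (ι x) (max (dist (ι x) m) (dist (ι x) q)) (le_max_left _ _) (le_max_right _ _)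
      have h2 : 0 ≤ max (dist (ι x) m) (dist (ι x) q) := dist_nonneg.trans (le_max_left _ _)
      have h3 : 0 ≤ α * (α - 1) / 8 * dist m q ^ 2 *
        max (dist (ι x) m) (dist (ι x) q) ^ (α - 2) := by positivity
      linarith
  have hind : Integrable (s.indicator fun _ => e) μ := (integrable_const e).indicator hsm
  have hint := integral_mono ((hi w).add hind) (((hi m).add (hi q)).div_const 2) hpt
  rw [integral_add' (hi w) hind, integral_div, integral_add' (hi m) (hi q),
    integral_indicator_const e hsm, smul_eq_mul] at hint
  calc α * (α - 1) / 4 * dist m q ^ 2 * (r + dist m q) ^ (α - 2) * μ.real s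
      = 2 * (μ.real s * e) := by rw [he]; ring
    _ ≤ _ := by linarith [hm w]

/-- Variance inequality for `α`-Fréchet means under a lower bound on small ball probabilities. -/
theorem IsHadamard.exists_min_le_excess {Q X : Type*} [MetricSpace Q] (hQ : IsHadamard Q)
    [TopologicalSpace X] [MeasurableSpace X] [OpensMeasurableSpace X]
    {ι : X → Q} (hι : Continuous ι) (μ : Measure X) [IsFiniteMeasure μ]
    {α β : ℝ} (hα : 1 < α) (hα2 : α ≤ 2) (hαβ : α ≤ β) {m : Q}
    (hmom : Integrable (fun x => dist (ι x) m ^ α) μ)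
    (hm : ∀ q, ∫ x, dist (ι x) m ^ α ∂μ ≤ ∫ x, dist (ι x) q ^ α ∂μ)
    {ε c : ℝ} (hε : 0 < ε) (hc : 0 < c)
    (hconc : ∀ r ∈ Ioc 0 ε, c * r ^ (β - α) ≤ μ.real {x | dist (ι x) m ≤ r}) :
    ∃ c₀ : ℝ, 0 < c₀ ∧ ∀ q, c₀ * min (dist m q ^ β) (dist m q ^ α) ≤
      ∫ x, dist (ι x) q ^ α ∂μ - ∫ x, dist (ι x) m ^ α ∂μ := by
  have hκ : 0 < α * (α - 1) := by nlinarith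
  refine ⟨α * (α - 1) / 8 * c * min 1 (ε ^ (β - α)), ?_, fun q => ?_⟩
  · have : 0 < min 1 (ε ^ (β - α)) := lt_min one_pos (by positivity)
    positivity
  -- Used with r = min(d(m,q), ε): r = d(m,q) yields the power β, while r = ε yields the power α
  -- with factor ε^(β-α).
  have key : ∀ r, 0 < r → r ≤ ε → r ≤ dist m q →
      α * (α - 1) / 8 * c * (r ^ (β - α) * dist m q ^ α) ≤
        ∫ x, dist (ι x) q ^ α ∂μ - ∫ x, dist (ι x) m ^ α ∂μ := by
    intro r hr hrε hrq
    have ha : 0 < dist m q := hr.trans_le hrq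
    refine le_trans ?_ (hQ.excess_ge_ball hι μ hα hα2 hmom hm q r)
    have h1 : (2 * dist m q) ^ (α - 2) ≤ (r + dist m q) ^ (α - 2) :=
      Real.rpow_le_rpow_of_nonpos (by positivity) (by linarith) (by linarith)
    have h2 : 1 / 2 * dist m q ^ (α - 2) ≤ (2 * dist m q) ^ (α - 2) := by
      rw [Real.mul_rpow (by norm_num) ha.le]
      gcongr
      calc (1 / 2 : ℝ) = 2 ^ (-1 : ℝ) := by rw [Real.rpow_neg_one]; norm_num
        _ ≤ 2 ^ (α - 2) := Real.rpow_le_rpow_of_exponent_le (by norm_num) (by linarith)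
    have h3 : dist m q ^ 2 * dist m q ^ (α - 2) = dist m q ^ α := by
      rw [← Real.rpow_natCast (dist m q) 2, ← Real.rpow_add ha]; norm_num
    have h4 := hconc r ⟨hr, hrε⟩
    calc α * (α - 1) / 8 * c * (r ^ (β - α) * dist m q ^ α)
        = α * (α - 1) / 4 * dist m q ^ 2 * (1 / 2 * dist m q ^ (α - 2)) *
          (c * r ^ (β - α)) := by rw [← h3]; ring
      _ ≤ α * (α - 1) / 4 * dist m q ^ 2 * (r + dist m q) ^ (α - 2) *
          μ.real {x | dist (ι x) m ≤ r} := by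
        gcongr
        exact h2.trans h1
  rcases eq_or_lt_of_le (dist_nonneg (x := m) (y := q)) with h0 | h0
  · rw [← h0, Real.zero_rpow (by linarith), Real.zero_rpow (by linarith), min_self, mul_zero]
    linarith [hm q]
  have hm1 : 0 ≤ min 1 (ε ^ (β - α)) := le_min zero_le_one (by positivity)
  rcases le_or_gt (dist m q) ε with h | h
  · refine le_trans ?_ (key _ h0 h le_rfl)
    rw [← Real.rpow_add h0, sub_add_cancel, mul_assoc]
    gcongr
    calc min 1 (ε ^ (β - α)) * min (dist m q ^ β) (dist m q ^ α)
        ≤ 1 * dist m q ^ β := by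
          gcongr
          · exact min_le_left _ _
          · exact min_le_left _ _
      _ = _ := one_mul _
  · refine le_trans ?_ (key _ hε le_rfl h.le)
    rw [mul_assoc]
    gcongr
    · exact min_le_right _ _
    · exact min_le_right _ _

/-! ### Transfer to the given probability space, and the rate. -/

/-- Combines the two excess risk bounds. As Q need not be second countable, a continuous map on its
n-fold product need not be measurable for the product σ-algebra; the law is therefore moved to the
closure of a separable set carrying Y. -/
theorem IsHadamard.exists_integral_min_le {Q Ω : Type*} [MetricSpace Q] [MeasurableSpace Q]
    [BorelSpace Q] (hQ : IsHadamard Q) [MeasurableSpace Ω] (P : Measure Ω)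
    [IsProbabilityMeasure P] {Y : Ω → Q} (hY : Measurable Y)
    (hYsep : ∃ s : Set Q, TopologicalSpace.IsSeparable s ∧ ∀ᵐ ω ∂P, Y ω ∈ s)
    {α β : ℝ} (hα : 1 < α) (hα2 : α ≤ 2) (hαβ : α ≤ β) {m : Q}
    (hm : IsPowerFrechetMean P α Y m) (hmoment : Integrable (fun ω => dist (Y ω) m ^ α) P)
    {ε c : ℝ} (hε : 0 < ε) (hc : 0 < c)
    (hconc : ∀ x ∈ Ioc 0 ε, c * x ^ (β - α) ≤ P.real {ω | dist (Y ω) m ≤ x}) :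
    ∃ C : ℝ, 0 < C ∧ ∀ n : ℕ, 1 ≤ n → ∀ (Z : Fin n → Ω → Q) (mn : Ω → Q),
      IsIIDSample P Y Z →
      (∀ᵐ ω ∂P, IsSamplePowerFrechetMean α (fun i => Z i ω) (mn ω)) →
        Integrable (fun ω => min (dist m (mn ω) ^ β) (dist m (mn ω) ^ α)) P ∧
        ∫ ω, min (dist m (mn ω) ^ β) (dist m (mn ω) ^ α) ∂P ≤ C / n := by
  classical
  obtain ⟨s, hs, hYs⟩ := hYsep
  set S : Set Q := closure s with hS
  have hSm : MeasurableSet S := isClosed_closure.measurableSet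
  have := hs.closure.secondCountableTopology
  have hYS : ∀ᵐ ω ∂P, Y ω ∈ S := hYs.mono fun ω h => subset_closure h
  obtain ⟨ω₀, hω₀⟩ := hYS.exists
  -- A measurable retraction onto `S`. The value off `S` is arbitrary, since it is taken with
  -- probability zero.
  set φ : Q → S := fun q => ⟨if q ∈ S then q else Y ω₀, by split_ifs with h; exacts [h, hω₀]⟩
    with hφdef
  have hφ : Measurable φ := (Measurable.ite hSm measurable_id measurable_const).subtype_mk
  have hφS : ∀ q ∈ S, (φ q : Q) = q := fun q hq => by simp [hφdef, hq]
  have hφY : ∀ᵐ ω ∂P, (φ (Y ω) : Q) = Y ω := hYS.mono fun ω h => hφS _ h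
  set μ : Measure S := P.map (φ ∘ Y) with hμ
  have hφYm : Measurable (φ ∘ Y) := hφ.comp hY
  have : IsProbabilityMeasure μ := Measure.isProbabilityMeasure_map hφYm.aemeasurable
  have hι : Continuous (Subtype.val : S → Q) := continuous_subtype_val
  have hcont : ∀ q, Continuous fun x : S => dist (x : Q) q ^ α := fun q =>
    (hι.dist continuous_const).rpow_const fun _ => Or.inr (by linarith)
  have hF : ∀ q, ∫ x : S, dist (x : Q) q ^ α ∂μ = ∫ ω, dist (Y ω) q ^ α ∂P := by
    intro q
    rw [hμ, integral_map hφYm.aemeasurable (hcont q).measurable.aestronglyMeasurable]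
    refine integral_congr_ae (hφY.mono fun ω h => ?_)
    simp only [Function.comp_apply, h]
  have hmom : Integrable (fun x : S => dist (x : Q) m ^ α) μ := by
    rw [hμ, integrable_map_measure (hcont m).measurable.aestronglyMeasurable hφYm.aemeasurable]
    refine hmoment.congr (hφY.mono fun ω h => ?_)
    simp only [Function.comp_apply, h]
  have hmμ : ∀ q, ∫ x : S, dist (x : Q) m ^ α ∂μ ≤ ∫ x : S, dist (x : Q) q ^ α ∂μ := fun q => by
    rw [hF, hF]; exact isMinOn_iff.1 hm q (mem_univ q)
  have hconcμ : ∀ r ∈ Ioc 0 ε, c * r ^ (β - α) ≤ μ.real {x : S | dist (x : Q) m ≤ r} := by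
    intro r hr
    refine (hconc r hr).trans (le_of_eq ?_)
    rw [hμ, map_measureReal_apply hφYm
      (isClosed_le (hι.dist continuous_const) continuous_const).measurableSet]
    refine measureReal_congr (hφY.mono fun ω h => ?_)
    refine propext ?_
    change dist (Y ω) m ≤ r ↔ dist (φ (Y ω) : Q) m ≤ r
    rw [h]
  obtain ⟨c₀, hc₀, hvar⟩ := hQ.exists_min_le_excess hι μ hα hα2 hαβ hmom hmμ hε hc hconcμ
  have hκ : 0 < α * (α - 1) := by nlinarith
  set V := ∫ x : S, dist (x : Q) m ^ α ∂μ with hV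
  have hV0 : 0 ≤ V := integral_nonneg fun x => by positivity
  -- The summand 1 only ensures positivity when V = 0.
  refine ⟨23040 * V / (α * (α - 1) / 8 * c₀) + 1, by positivity, ?_⟩
  intro n hn Z mn hZ hmn
  have hn' : (0 : ℝ) < n := by exact_mod_cast hn
  choose T hT using hQ.exists_isSamplePowerFrechetMean hn hα hα2
  have hTc : Continuous T := IsSamplePowerFrechetMean.continuous hQ hn hα hα2 hT
  have hZm : ∀ i, AEMeasurable (fun ω => φ (Z i ω)) P := fun i =>
    hφ.comp_aemeasurable (hZ.ident i).aemeasurable_fst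
  have hZmap : P.map (fun ω i => φ (Z i ω)) = Measure.pi fun _ => μ := by
    have hind : iIndepFun (fun i ω => φ (Z i ω)) P := hZ.indep.comp (fun _ => φ) fun _ => hφ
    rw [(iIndepFun_iff_map_fun_eq_pi_map hZm).1 hind]
    congr 1
    ext1 i
    exact ((hZ.ident i).comp hφ).map_eq
  have hZS : ∀ᵐ ω ∂P, ∀ i, Z i ω ∈ S := ae_all_iff.2 fun i =>
    (hZ.ident i).symm.ae_mem_snd hSm hYS
  set g : (Fin n → S) → ℝ := fun y =>
    min (dist m (T (Subtype.val ∘ y)) ^ β) (dist m (T (Subtype.val ∘ y)) ^ α) with hg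
  have hgc : Continuous g := by
    have h1 : Continuous fun y : Fin n → S => dist m (T (Subtype.val ∘ y)) :=
      continuous_const.dist
        (hTc.comp (continuous_pi fun j => hι.comp (continuous_apply _)))
    exact (h1.rpow_const fun _ => Or.inr (by linarith)).min
      (h1.rpow_const fun _ => Or.inr (by linarith))
  have hgmn : (fun ω => g fun i => φ (Z i ω)) =ᵐ[P]
      fun ω => min (dist m (mn ω) ^ β) (dist m (mn ω) ^ α) := by
    filter_upwards [hZS, hmn] with ω h1 h2
    have e : (Subtype.val ∘ fun i => φ (Z i ω)) = fun i => Z i ω :=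
      funext fun i => hφS _ (h1 i)
    simp only [hg, e, (hT fun i => Z i ω).unique hQ hn hα hα2 h2]
  obtain ⟨hint, hle⟩ := hQ.integral_excess_le hι μ hα hα2 m hmom hn hT
  have hg0 : ∀ y, 0 ≤ g y := fun y => le_min (by positivity) (by positivity)
  have hexc := hint.sub (integrable_const V)
  have hgle : ∀ y : Fin n → S, c₀ * g y ≤
      ∫ x : S, dist (x : Q) (T (Subtype.val ∘ y)) ^ α ∂μ - V := fun y => hvar _
  have hgi : Integrable g (Measure.pi fun _ => μ) := by
    refine (hexc.const_mul c₀⁻¹).mono' hgc.measurable.aestronglyMeasurable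
      (Eventually.of_forall fun y => ?_)
    rw [Real.norm_of_nonneg (hg0 y), inv_mul_eq_div, le_div_iff₀ hc₀, mul_comm]
    exact hgle y
  have hZam : AEMeasurable (fun ω i => φ (Z i ω)) P := aemeasurable_pi_lambda _ hZm
  constructor
  · refine Integrable.congr ?_ hgmn
    rw [← hZmap] at hgi
    exact hgi.comp_aemeasurable hZam
  · rw [← integral_congr_ae hgmn]
    have e1 : ∫ ω, g (fun i => φ (Z i ω)) ∂P = ∫ y, g y ∂(Measure.pi fun _ => μ) := by
      rw [← hZmap, integral_map hZam hgc.measurable.aestronglyMeasurable]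
    rw [e1]
    have h1 := integral_mono (hgi.const_mul c₀) hexc hgle
    rw [integral_const_mul, integral_sub' hint (integrable_const V), integral_const] at h1
    simp only [probReal_univ, one_smul] at h1
    have h2 := mul_le_mul_of_nonneg_left h1 (show 0 ≤ α * (α - 1) / 8 * n by positivity)
    rw [le_div_iff₀ hn']
    have h3 : (∫ y, g y ∂(Measure.pi fun _ => μ)) * n ≤
        23040 * V / (α * (α - 1) / 8 * c₀) := by
      rw [le_div_iff₀ (by positivity)]
      linarith
    linarith

theorem isLittleO_natCast_rpow {a b : ℝ} (h : a < b) :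
    (fun n : ℕ => (n : ℝ) ^ a) =o[atTop] (fun n : ℕ => (n : ℝ) ^ b) := by
  rw [Asymptotics.isLittleO_iff_tendsto']
  · have := (tendsto_rpow_neg_atTop (sub_pos.2 h)).comp (tendsto_natCast_atTop_atTop (R := ℝ))
    refine this.congr' ?_
    filter_upwards [eventually_gt_atTop 0] with n hn
    have hn' : (0 : ℝ) < n := by exact_mod_cast hn
    simp only [Function.comp_apply]
    rw [← Real.rpow_sub hn', neg_sub]
  · filter_upwards [eventually_gt_atTop 0] with n hn h0
    have hn' : (0 : ℝ) < n := by exact_mod_cast hn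
    exact absurd h0 (by positivity)

theorem mainTheorem11 {Q Ω : Type*} [MetricSpace Q] [MeasurableSpace Q] [BorelSpace Q]
    (hQ : IsHadamard Q) [MeasurableSpace Ω] (P : Measure Ω) [IsProbabilityMeasure P]
    (Y : Ω → Q) (hY : Measurable Y)
    (hYsep : ∃ s : Set Q, TopologicalSpace.IsSeparable s ∧ ∀ᵐ ω ∂P, Y ω ∈ s)
    (α β : ℝ) (hα : 1 < α) (hα2 : α ≤ 2) (hαβ : α ≤ β) (hβ : β ≤ 2)
    (m : Q) (hm : IsPowerFrechetMean P α Y m)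
    (hmoment : Integrable (fun ω => dist (Y ω) m ^ α) P)
    (ε c : ℝ) (hε : 0 < ε) (hc : 0 < c)
    (hconc : ∀ x ∈ Ioc 0 ε, c * x ^ (β - α) ≤ P.real {ω | dist (Y ω) m ≤ x}) :
    (∃ C : ℝ, 0 < C ∧ ∀ n : ℕ, 1 ≤ n → ∀ (Z : Fin n → Ω → Q) (mn : Ω → Q),
      IsIIDSample P Y Z →
      (∀ᵐ ω ∂P, IsSamplePowerFrechetMean α (fun i => Z i ω) (mn ω)) →
        Integrable (fun ω => min (dist m (mn ω) ^ β) (dist m (mn ω) ^ α)) P ∧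
        ∫ ω, min (dist m (mn ω) ^ β) (dist m (mn ω) ^ α) ∂P ≤ C / n) ∧
    (∀ η : ℝ, 0 < η → ∃ K : ℝ, 0 < K ∧ ∀ n : ℕ, 1 ≤ n → ∀ (Z : Fin n → Ω → Q) (mn : Ω → Q),
      IsIIDSample P Y Z →
      (∀ᵐ ω ∂P, IsSamplePowerFrechetMean α (fun i => Z i ω) (mn ω)) →
        P.real {ω | K * (n : ℝ) ^ (-(1 / β)) < dist m (mn ω)} ≤ η) ∧
    (β < 2 → (fun n : ℕ => (n : ℝ) ^ (-(1 / β))) =o[atTop]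
      (fun n : ℕ => (n : ℝ) ^ (-(1 / 2 : ℝ)))) := by

  obtain ⟨C, hC, hCn⟩ :=
    hQ.exists_integral_min_le P hY hYsep hα hα2 hαβ hm hmoment hε hc hconc
  refine ⟨⟨C, hC, hCn⟩, fun η hη => ?_, fun hβ2 => ?_⟩
  · have hK1 : 1 ≤ max 1 (C / η) := le_max_left _ _
    have hKC : C ≤ max 1 (C / η) * η := by
      rw [← div_le_iff₀ hη]; exact le_max_right _ _
    set K := max 1 (C / η)
    refine ⟨K, by linarith, fun n hn Z mn hZ hmn => ?_⟩
    obtain ⟨hint, hle⟩ := hCn n hn Z mn hZ hmn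
    have hn1 : (1 : ℝ) ≤ n := by exact_mod_cast hn
    have hn' : (0 : ℝ) < n := by linarith
    -- K ≥ 1 gives K ≤ K^γ, and γ ≤ β gives 1/n ≤ n^(-γ/β). With γ = β and γ = α, the event d > K
    -- n^(-1/β) forces the minimum above K/n, so Markov's inequality applies.
    have hpow : ∀ γ : ℝ, 1 ≤ γ → γ ≤ β → ∀ d : ℝ, K * (n : ℝ) ^ (-(1 / β)) < d →
        K / n ≤ d ^ γ := by
      intro γ hγ hγβ d hd
      have h1 : K ≤ K ^ γ := by
        simpa using Real.rpow_le_rpow_of_exponent_le hK1 hγ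
      have h2 : (n : ℝ)⁻¹ ≤ ((n : ℝ) ^ (-(1 / β))) ^ γ := by
        rw [← Real.rpow_mul hn'.le, ← Real.rpow_neg_one]
        refine Real.rpow_le_rpow_of_exponent_le hn1 ?_
        have : γ / β ≤ 1 := (div_le_one (by linarith)).2 hγβ
        rw [neg_mul, one_div_mul_eq_div]
        linarith
      calc K / n = K * (n : ℝ)⁻¹ := div_eq_mul_inv _ _
        _ ≤ K ^ γ * ((n : ℝ) ^ (-(1 / β))) ^ γ := by gcongr
        _ = (K * (n : ℝ) ^ (-(1 / β))) ^ γ := by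
            rw [Real.mul_rpow (by linarith) (by positivity)]
        _ ≤ d ^ γ := by gcongr
    have hsub : {ω | K * (n : ℝ) ^ (-(1 / β)) < dist m (mn ω)} ⊆
        {ω | K / n ≤ min (dist m (mn ω) ^ β) (dist m (mn ω) ^ α)} := fun ω hω =>
      le_min (hpow β (by linarith) le_rfl _ hω) (hpow α hα.le hαβ _ hω)
    have hmarkov := mul_meas_ge_le_integral_of_nonneg
      (Eventually.of_forall fun ω => le_min (by positivity) (by positivity)) hint (K / n)
    have h3 := measureReal_mono (μ := P) hsub
    have h4 : K / n * P.real {ω | K * (n : ℝ) ^ (-(1 / β)) < dist m (mn ω)} ≤ C / n :=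
      (mul_le_mul_of_nonneg_left h3 (by positivity)).trans (hmarkov.trans hle)
    rw [div_mul_eq_mul_div, div_le_div_iff_of_pos_right hn'] at h4
    exact le_of_mul_le_mul_left (h4.trans hKC) (by linarith)
  · apply isLittleO_natCast_rpow
    rw [neg_lt_neg_iff]
    exact one_div_lt_one_div_of_lt (by linarith) hβ2
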